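/- Let $k\ge 1$ be an integer. For $x>0$ consider the following system on the halfline $[0,\infty)$. At time $0$ there are $k$ workers, all located at the point $x$, and dust particles located at the origin and at the points of a rate-$1$ Poisson process on $(x,\infty)$. Each worker has a clock whose ring times form a rate-$1$ Poisson process on the time halfline $(0,\infty)$; the $k$ clocks and the dust process are mutually independent. Whenever the clock of a worker rings, this worker instantaneously jumps to the closest dust particle that has not yet been removed, removes it, and stays there until his clock rings again. Let $D_k(x)$ be the event that the dust particle at the origin is never removed, and let $P_k(x)$ be its probability. Then $$\lim_{x\downarrow 0}\frac{\log P_k(x)}{\log^2 x}=-\frac{k}{2\log 2},$$ where $\log^2 x=(\log x)^2$. -/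

import Mathlib

open MeasureTheory ProbabilityTheory

noncomputable section

namespace GreedyCleaning

/-- The `n`-th spacing of a sequence of random points `T 0, T 1, …` to the right of `a`:
`T 0 - a` for `n = 0`, and `T n - T (n - 1)` for `n ≥ 1`. -/
def spacing {Ω : Type*} (a : ℝ) (T : ℕ → Ω → ℝ) : ℕ → Ω → ℝ
  | 0 => fun ω => T 0 ω - a
  | n + 1 => fun ω => T (n + 1) ω - T n ω

/-- `T 0, T 1, …` are the successive points of a rate-1 Poisson process on `(a, ∞)`:
the spacings are independent and exponentially distributed with parameter 1. -/
structure IsPoissonProcess {Ω : Type*} [MeasurableSpace Ω] (a : ℝ) (T : ℕ → Ω → ℝ)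
    (μ : Measure Ω) : Prop where
  measurable : ∀ n, Measurable (T n)
  spacing_law : ∀ n, HasLaw (spacing a T n) (expMeasure 1) μ
  spacing_indep : iIndepFun (spacing a T) μ

/-- The dust process and the `k` clocks, as one family of random sequences
(`none` is the dust, `some j` is the clock of worker `j`). -/
def dustAndClocks {Ω : Type*} {k : ℕ} (T : ℕ → Ω → ℝ) (R : Fin k → ℕ → Ω → ℝ) :
    Option (Fin k) → Ω → (ℕ → ℝ)
  | none => fun ω n => T n ω
  | some j => fun ω n => R j n ω

/-- The randomness of the half-line model with `k` workers that start at `x`: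
`T` lists the dust on `(x, ∞)`, which is a rate-1 Poisson process; `R j` lists the ring times of
the clock of worker `j`, which is a rate-1 Poisson process on the time half-line; and the dust and
the `k` clocks are mutually independent. -/
structure IsHalflineModel {Ω : Type*} [MeasurableSpace Ω] (k : ℕ) (x : ℝ) (T : ℕ → Ω → ℝ)
    (R : Fin k → ℕ → Ω → ℝ) (μ : Measure Ω) : Prop where
  dust_poisson : IsPoissonProcess x T μ
  clock_poisson : ∀ j, IsPoissonProcess 0 (R j) μ
  indep : iIndepFun (dustAndClocks T R) μ

/-- Locations of the dust particles: particle `0` is at the origin, and particle `n + 1` is the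
`n`-th particle of `d`. -/
def particle (d : ℕ → ℝ) : ℕ → ℝ
  | 0 => 0
  | n + 1 => d n

/-- State of the system after finitely many rings. -/
structure State (k : ℕ) where
  /-- the location of each worker -/
  pos : Fin k → ℝ
  /-- the (labels of the) dust particles that have not been removed -/
  present : Set ℕ
  /-- how many times the clock of each worker has rung -/
  rings : Fin k → ℕ

/-- Worker `j` is the one whose clock rings next: among the next ring times of all the workers
his is the earliest (the smallest index in the case of a tie, which has probability zero). -/
def IsNextRinger {k : ℕ} (r : Fin k → ℕ → ℝ) (s : State k) (j : Fin k) : Prop :=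
  ∀ i, r j (s.rings j) < r i (s.rings i) ∨ (r j (s.rings j) = r i (s.rings i) ∧ j ≤ i)

/-- Particle `m` is the closest existing one to the point `y` (the smallest label in the case of a
tie, so that the origin wins against any other particle; ties have probability zero). -/
def IsClosest (loc : ℕ → ℝ) (present : Set ℕ) (y : ℝ) (m : ℕ) : Prop :=
  m ∈ present ∧ ∀ i ∈ present, |loc m - y| < |loc i - y| ∨ (|loc m - y| = |loc i - y| ∧ m ≤ i)

theorem IsNextRinger.unique {k : ℕ} {r : Fin k → ℕ → ℝ} {s : State k} {i j : Fin k}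
    (hi : IsNextRinger r s i) (hj : IsNextRinger r s j) : i = j := by
  rcases hi j with h | ⟨h, h'⟩ <;> rcases hj i with g | ⟨g, g'⟩
  · exact absurd (h.trans g) (lt_irrefl _)
  · exact absurd g h.ne'
  · exact absurd h g.ne'
  · exact le_antisymm h' g'

theorem IsClosest.unique {loc : ℕ → ℝ} {K : Set ℕ} {y : ℝ} {m n : ℕ}
    (hm : IsClosest loc K y m) (hn : IsClosest loc K y n) : m = n := by
  rcases hm.2 n hn.1 with h | ⟨h, h'⟩ <;> rcases hn.2 m hm.1 with g | ⟨g, g'⟩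
  · exact absurd (h.trans g) (lt_irrefl _)
  · exact absurd g h.ne'
  · exact absurd h g.ne'
  · exact le_antisymm h' g'

open Classical in
/-- The next ring: the worker whose clock rings jumps to the closest existing particle and removes
it; every other worker and every other particle stays as it is. -/
def step {k : ℕ} (loc : ℕ → ℝ) (r : Fin k → ℕ → ℝ) (s : State k) : State k where
  pos j :=
    if h : IsNextRinger r s j ∧ ∃ m, IsClosest loc s.present (s.pos j) m then
      loc h.2.choose
    else s.pos j
  present :=
    {m | m ∈ s.present ∧ ¬ ∃ j, IsNextRinger r s j ∧ IsClosest loc s.present (s.pos j) m}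
  rings j := if IsNextRinger r s j then s.rings j + 1 else s.rings j

/-- The state after the first `n` rings (of all the clocks together), when all `k` workers start
at `x`, the dust is at the origin and at the points `d 0, d 1, …`, and the clock of worker `j`
rings at the times `r j 0, r j 1, …`. -/
def stateAfter {k : ℕ} (x : ℝ) (d : ℕ → ℝ) (r : Fin k → ℕ → ℝ) : ℕ → State k
  | 0 => { pos := fun _ => x, present := Set.univ, rings := fun _ => 0 }
  | n + 1 => step (particle d) r (stateAfter x d r n)

/-- The event that the dust particle at the origin is never removed. -/
def originNeverRemoved {Ω : Type*} {k : ℕ} (x : ℝ) (T : ℕ → Ω → ℝ) (R : Fin k → ℕ → Ω → ℝ) :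
    Set Ω :=
  {ω | ∀ n, 0 ∈ (stateAfter x (fun i => T i ω) (fun j i => R j i ω) n).present}

end GreedyCleaning

end

/-!
As long as the origin has not been removed, the dust is removed from left to right, and a worker
at `y` who rings when the leftmost remaining particle on his right is at `t` spares the origin if
and only if `t < 2 * y`. So the question is how the workers, by jumps that less than double their
distance to the origin, get from `x` to distances of order one, where the dust is dense.

*Upper bound.* Almost surely no clock accumulates rings, so every worker rings again and again,
and on survival the leftmost remaining particle is always at less than twice the position of the
last worker. Among `k - 1` consecutive rings one worker does not move; hence the `k * q`-th
particle is at most at `2 ^ q * x` (`startAndDust_le_of_mem`). Then each of the independent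
spacings numbered `i < k * N` is less than `2 ^ (i / k + 1) * x`, which has probability at most
`2 ^ (i / k + 1) * x`. With `L = -log x` and `N = ⌊L / log 2⌋` the logarithm of the product is
`-k / (2 * log 2) * L ^ 2` to leading order.

*Lower bound.* Fix `1 < ρ < 2`. During the first `N`, about `L / log ρ`, rounds, prescribe short
windows for the spacings of the clocks, so that the workers ring in turn, and windows for the dust
spacings, of lengths proportional to `ρ ^ q * x` in round `q`, so that every worker's distance to
the origin is multiplied by about `ρ` in each round. The clock windows have length of order `1 / N`,
which costs only `exp (-O(L * log L))`; the dust windows cost `exp (-k / (2 * log ρ) * L ^ 2)` to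
leading order. The later spacings are independent of the earlier ones, and by the strong law of
large numbers they are regular (`IsRegular`) with probability at least `1 / 2` for a suitable
constant. Regularity keeps the numbers of rings of the workers comparable forever, so no worker
falls behind by a factor of two, provided that the first phase ends at a large enough, but
bounded, distance from the origin (`mem_present_of_windows`). Finally `ρ` tends to `2`.
-/

open MeasureTheory ProbabilityTheory

namespace GreedyCleaning

/-! ### The deterministic dynamics -/

section Dynamics

variable {k : ℕ} {x : ℝ} {d : ℕ → ℝ} {r : Fin k → ℕ → ℝ}

theorem exists_isNextRinger (hk : 0 < k) (r : Fin k → ℕ → ℝ) (s : State k) :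
    ∃ j, IsNextRinger r s j := by
  have : Nonempty (Fin k) := ⟨⟨0, hk⟩⟩
  obtain ⟨j, hj⟩ := Finite.exists_min fun j : Fin k => toLex (r j (s.rings j), j)
  exact ⟨j, fun i => Prod.Lex.toLex_le_toLex.1 (hj i)⟩

theorem IsNextRinger.le {s : State k} {j : Fin k} (h : IsNextRinger r s j) (i : Fin k) :
    r j (s.rings j) ≤ r i (s.rings i) := by
  rcases h i with h | h
  exacts [h.le, h.1.le]

theorem step_rings {loc : ℕ → ℝ} {s : State k} {J : Fin k} (hJ : IsNextRinger r s J) :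
    (step loc r s).rings = Function.update s.rings J (s.rings J + 1) := by
  funext j
  by_cases h : j = J
  · subst h
    simp [step, hJ]
  · have : ¬ IsNextRinger r s j := fun h' => h (h'.unique hJ)
    simp [step, h, this]

theorem step_pos {loc : ℕ → ℝ} {s : State k} {J : Fin k} {m : ℕ} (hJ : IsNextRinger r s J)
    (hm : IsClosest loc s.present (s.pos J) m) :
    (step loc r s).pos = Function.update s.pos J (loc m) := by
  funext j
  by_cases h : j = J
  · subst h
    have h2 : IsNextRinger r s j ∧ ∃ m, IsClosest loc s.present (s.pos j) m := ⟨hJ, m, hm⟩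
    have h3 : h2.2.choose = m := h2.2.choose_spec.unique hm
    simp only [step, Function.update_self]
    rw [dif_pos h2, h3]
  · have : ¬ IsNextRinger r s j := fun h' => h (h'.unique hJ)
    simp [step, h, this]

theorem step_present {loc : ℕ → ℝ} {s : State k} {J : Fin k} {m : ℕ} (hJ : IsNextRinger r s J)
    (hm : IsClosest loc s.present (s.pos J) m) :
    (step loc r s).present = s.present \ {m} := by
  ext i
  simp only [step, Set.mem_ofPred_eq, Set.mem_sdiff, Set.mem_singleton_iff]
  refine and_congr_right fun hi => not_congr ⟨?_, ?_⟩
  · rintro ⟨j, hj, hc⟩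
    rw [hj.unique hJ] at hc
    exact hc.unique hm
  · rintro rfl
    exact ⟨J, hJ, hm⟩

/-- The dust to the right of the origin together with the starting point of the workers:
`startAndDust x d 0 = x` and `startAndDust x d (n + 1) = d n`. After `n` rings that spare the
origin, the rightmost worker is at `startAndDust x d n`. -/
def startAndDust (x : ℝ) (d : ℕ → ℝ) : ℕ → ℝ
  | 0 => x
  | n + 1 => d n

theorem startAndDust_eq_particle {n : ℕ} (hn : n ≠ 0) : startAndDust x d n = particle d n := by
  cases n with
  | zero => exact absurd rfl hn
  | succ n => rfl

/-- The situation after `n` rings none of which removed the origin: the first `n` particles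
on the right of the workers are gone, and all the others are still there and lie to the right of
all the workers. -/
structure OriginSpared (x : ℝ) (d : ℕ → ℝ) (n : ℕ) (s : State k) : Prop where
  present_eq : s.present = {m | m = 0 ∨ n < m}
  le_pos : ∀ j, x ≤ s.pos j
  pos_le : ∀ j, s.pos j ≤ startAndDust x d n

theorem OriginSpared.isClosest_right (hx : 0 < x) (hd : StrictMono (startAndDust x d))
    {n : ℕ} {s : State k} (h : OriginSpared x d n s) {j : Fin k} (hj : d n < 2 * s.pos j) :
    IsClosest (particle d) s.present (s.pos j) (n + 1) := by
  have h1 := h.le_pos j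
  have h2 := h.pos_le j
  have h3 : startAndDust x d n < d n := hd n.lt_succ_self
  refine ⟨by simp [h.present_eq], fun i hi => ?_⟩
  rw [h.present_eq] at hi
  have e1 : |particle d (n + 1) - s.pos j| = d n - s.pos j := by
    simp only [particle]
    exact abs_of_nonneg (by linarith)
  rcases hi with rfl | hi
  · left
    have e2 : |particle d 0 - s.pos j| = s.pos j := by
      simp only [particle, zero_sub, abs_neg]
      exact abs_of_nonneg (hx.le.trans h1)
    rw [e1, e2]
    linarith
  · have h4 : d n ≤ particle d i := by
      rw [← startAndDust_eq_particle (x := x) (by omega)]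
      exact hd.monotone hi
    have e2 : |particle d i - s.pos j| = particle d i - s.pos j := abs_of_nonneg (by linarith)
    rw [e1, e2]
    rcases h4.lt_or_eq with h5 | h5
    · left; linarith
    · right; exact ⟨by linarith, hi⟩

theorem OriginSpared.isClosest_origin (hx : 0 < x) (hd : StrictMono (startAndDust x d))
    {n : ℕ} {s : State k} (h : OriginSpared x d n s) {j : Fin k} (hj : 2 * s.pos j ≤ d n) :
    IsClosest (particle d) s.present (s.pos j) 0 := by
  have h1 := h.le_pos j
  have e2 : |particle d 0 - s.pos j| = s.pos j := by
    simp only [particle, zero_sub, abs_neg]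
    exact abs_of_nonneg (by linarith)
  refine ⟨by simp [h.present_eq], fun i hi => ?_⟩
  rw [h.present_eq] at hi
  rcases hi with rfl | hi
  · exact Or.inr ⟨rfl, le_rfl⟩
  · have h4 : d n ≤ particle d i := by
      rw [← startAndDust_eq_particle (x := x) (by omega)]
      exact hd.monotone hi
    have e3 : |particle d i - s.pos j| = particle d i - s.pos j := abs_of_nonneg (by linarith)
    rw [e2, e3]
    rcases (show s.pos j ≤ particle d i - s.pos j by linarith).lt_or_eq with h5 | h5
    · exact Or.inl h5
    · exact Or.inr ⟨h5, i.zero_le⟩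

theorem OriginSpared.step (hx : 0 < x) (hd : StrictMono (startAndDust x d))
    {n : ℕ} {s : State k} (h : OriginSpared x d n s) {J : Fin k} (hJ : IsNextRinger r s J)
    (hlt : d n < 2 * s.pos J) :
    OriginSpared x d (n + 1) (step (particle d) r s) := by
  have hc := h.isClosest_right hx hd hlt
  have hlt' : startAndDust x d n < startAndDust x d (n + 1) := hd n.lt_succ_self
  refine ⟨?_, fun j => ?_, fun j => ?_⟩
  · rw [step_present hJ hc, h.present_eq]
    ext m
    simp only [Set.mem_sdiff, Set.mem_ofPred_eq, Set.mem_singleton_iff]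
    omega
  · rw [step_pos hJ hc]
    by_cases hj : j = J
    · subst hj
      rw [Function.update_self]
      exact (h.le_pos j).trans ((h.pos_le j).trans hlt'.le)
    · rw [Function.update_of_ne hj]
      exact h.le_pos j
  · rw [step_pos hJ hc]
    by_cases hj : j = J
    · subst hj
      rw [Function.update_self]
      exact le_rfl
    · rw [Function.update_of_ne hj]
      exact (h.pos_le j).trans hlt'.le

theorem originSpared_zero : OriginSpared x d 0 (stateAfter x d r 0) :=
  ⟨by ext m; simp [stateAfter]; omega, fun _ => le_rfl, fun _ => le_rfl⟩

/-- As long as the origin is there, every jump so far went to the right, over a distance smaller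
than the distance of the worker to the origin. -/
theorem originSpared_of_mem (hk : 0 < k) (hx : 0 < x) (hd : StrictMono (startAndDust x d))
    (h : ∀ n, 0 ∈ (stateAfter x d r n).present) (n : ℕ) :
    OriginSpared x d n (stateAfter x d r n) ∧
      ∀ J, IsNextRinger r (stateAfter x d r n) J → d n < 2 * (stateAfter x d r n).pos J := by
  have key : ∀ n, OriginSpared x d n (stateAfter x d r n) →
      ∀ J, IsNextRinger r (stateAfter x d r n) J → d n < 2 * (stateAfter x d r n).pos J := by
    intro n hn J hJ
    by_contra! hle
    have := h (n + 1)
    rw [stateAfter, step_present hJ (hn.isClosest_origin hx hd hle)] at this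
    exact this.2 rfl
  suffices OriginSpared x d n (stateAfter x d r n) from ⟨this, key n this⟩
  induction n with
  | zero => exact originSpared_zero
  | succ n ih =>
    obtain ⟨J, hJ⟩ := exists_isNextRinger hk r (stateAfter x d r n)
    exact ih.step hx hd hJ (key n ih J hJ)

/-- A criterion for survival: `B m` is a lower bound for the position of a worker that has rung
`m` times. -/
theorem mem_present_of_bound (hk : 0 < k) (hx : 0 < x) (hd : StrictMono (startAndDust x d))
    (B : ℕ → ℝ) (hB0 : B 0 ≤ x)
    (hB : ∀ n J, IsNextRinger r (stateAfter x d r n) J →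
      B ((stateAfter x d r n).rings J + 1) ≤ d n ∧
        d n < 2 * B ((stateAfter x d r n).rings J)) (n : ℕ) :
    0 ∈ (stateAfter x d r n).present := by
  suffices OriginSpared x d n (stateAfter x d r n) ∧
      ∀ j, B ((stateAfter x d r n).rings j) ≤ (stateAfter x d r n).pos j by
    rw [this.1.present_eq]
    exact Or.inl rfl
  induction n with
  | zero => exact ⟨originSpared_zero, fun _ => hB0⟩
  | succ n ih =>
    obtain ⟨J, hJ⟩ := exists_isNextRinger hk r (stateAfter x d r n)
    obtain ⟨h1, h2⟩ := hB n J hJ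
    have h3 : d n < 2 * (stateAfter x d r n).pos J := by linarith [ih.2 J]
    refine ⟨ih.1.step hx hd hJ h3, fun j => ?_⟩
    rw [stateAfter, step_rings hJ, step_pos hJ (ih.1.isClosest_right hx hd h3)]
    by_cases hj : j = J
    · subst hj
      simpa [particle] using h1
    · simpa [Function.update_of_ne hj] using ih.2 j

/-! ### Ring counts -/

theorem rings_succ {n : ℕ} {J : Fin k} (hJ : IsNextRinger r (stateAfter x d r n) J) :
    (stateAfter x d r (n + 1)).rings =
      Function.update (stateAfter x d r n).rings J ((stateAfter x d r n).rings J + 1) :=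
  step_rings hJ

theorem rings_le_succ (hk : 0 < k) (n : ℕ) (j : Fin k) :
    (stateAfter x d r n).rings j ≤ (stateAfter x d r (n + 1)).rings j := by
  obtain ⟨J, hJ⟩ := exists_isNextRinger hk r (stateAfter x d r n)
  rw [rings_succ hJ]
  by_cases hj : j = J
  · subst hj
    simp
  · simp [Function.update_of_ne hj]

theorem rings_mono (hk : 0 < k) (j : Fin k) :
    Monotone fun n => (stateAfter x d r n).rings j :=
  monotone_nat_of_le_succ fun n => rings_le_succ hk n j

theorem sum_rings (hk : 0 < k) (n : ℕ) : ∑ j, (stateAfter x d r n).rings j = n := by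
  induction n with
  | zero => simp [stateAfter]
  | succ n ih =>
    obtain ⟨J, hJ⟩ := exists_isNextRinger hk r (stateAfter x d r n)
    rw [rings_succ hJ, Finset.sum_update_of_mem (Finset.mem_univ J)]
    have := Finset.add_sum_erase Finset.univ (stateAfter x d r n).rings (Finset.mem_univ J)
    rw [Finset.erase_eq] at this
    omega

/-- The rings happen in the order of their times: every ring in the past precedes every
pending ring. -/
theorem past_ring_le_pending (hk : 0 < k) (hr : ∀ j, Monotone (r j)) (n : ℕ) (i j : Fin k) (m : ℕ)
    (hm : (stateAfter x d r n).rings i = m + 1) :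
    r i m ≤ r j ((stateAfter x d r n).rings j) := by
  induction n generalizing i j m with
  | zero => simp [stateAfter] at hm
  | succ n ih =>
    obtain ⟨J, hJ⟩ := exists_isNextRinger hk r (stateAfter x d r n)
    have h1 : r j ((stateAfter x d r n).rings j) ≤ r j ((stateAfter x d r (n + 1)).rings j) :=
      hr j (rings_le_succ hk n j)
    refine le_trans ?_ h1
    rw [rings_succ hJ] at hm
    by_cases hi : i = J
    · subst hi
      rw [Function.update_self, Nat.add_right_cancel_iff] at hm
      subst hm
      exact hJ.le j
    · rw [Function.update_of_ne hi] at hm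
      exact ih i j m hm

/-- If none of the clocks accumulates rings at a finite time, every worker rings infinitely
often. -/
theorem exists_ge_isNextRinger (hk : 0 < k)
    (hr : ∀ j, Filter.Tendsto (r j) Filter.atTop Filter.atTop) (j : Fin k) (n : ℕ) :
    ∃ m, n ≤ m ∧ IsNextRinger r (stateAfter x d r m) j := by
  by_contra! hno
  set c := (stateAfter x d r n).rings j with hc
  -- the pending ring of `j` never takes place, so all later rings are not after it
  have hconst : ∀ m, n ≤ m → (stateAfter x d r m).rings j = c := by
    intro m hm
    induction m, hm using Nat.le_induction with
    | base => rfl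
    | succ m hm ih =>
      obtain ⟨J, hJ⟩ := exists_isNextRinger hk r (stateAfter x d r m)
      have hne : j ≠ J := by
        rintro rfl
        exact hno m hm hJ
      rw [rings_succ hJ, Function.update_of_ne hne, ih]
  have hb : ∀ i, ∃ b, ∀ m, b ≤ m → r j c < r i m := fun i =>
    Filter.eventually_atTop.1 ((hr i).eventually_gt_atTop (r j c))
  choose b hb using hb
  have hbound : ∀ m, n ≤ m → ∀ i,
      (stateAfter x d r m).rings i ≤ (stateAfter x d r n).rings i + b i := by
    intro m hm
    induction m, hm using Nat.le_induction with
    | base => intro i; omega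
    | succ m hm ih =>
      intro i
      obtain ⟨J, hJ⟩ := exists_isNextRinger hk r (stateAfter x d r m)
      rw [rings_succ hJ]
      by_cases hi : i = J
      · subst hi
        rw [Function.update_self]
        have h1 := hJ.le j
        rw [hconst m hm] at h1
        have h2 : (stateAfter x d r m).rings i < b i := by
          by_contra! h
          exact absurd (hb i _ h) (not_lt.2 h1)
        omega
      · rw [Function.update_of_ne hi]
        exact ih i
  set S := ∑ i, ((stateAfter x d r n).rings i + b i) with hS
  have h1 := Finset.sum_le_sum fun i (_ : i ∈ Finset.univ) =>
    hbound (n + S + 1) (by omega) i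
  rw [sum_rings hk, ← hS] at h1
  omega

/-! ### Survival forces the dust to be dense near the origin -/

theorem lt_two_mul_pos (hk : 0 < k) (hx : 0 < x) (hd : StrictMono (startAndDust x d))
    (hr : ∀ j, Filter.Tendsto (r j) Filter.atTop Filter.atTop)
    (h : ∀ n, 0 ∈ (stateAfter x d r n).present) (n : ℕ) (j : Fin k) :
    d n < 2 * (stateAfter x d r n).pos j := by
  classical
  -- consider the next ring of `j`; he has not moved in the meantime
  have hex := exists_ge_isNextRinger (x := x) (d := d) hk hr j n
  obtain ⟨hnm, hm⟩ := Nat.find_spec hex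
  have hpos : ∀ m, n ≤ m → m ≤ Nat.find hex →
      (stateAfter x d r m).pos j = (stateAfter x d r n).pos j := by
    intro m hm
    induction m, hm using Nat.le_induction with
    | base => intro _; rfl
    | succ m hm ih =>
      intro hle
      obtain ⟨J, hJ⟩ := exists_isNextRinger hk r (stateAfter x d r m)
      have hne : j ≠ J := by
        rintro rfl
        exact Nat.find_min hex (Nat.lt_of_succ_le hle) ⟨hm, hJ⟩
      obtain ⟨h1, h2⟩ := originSpared_of_mem hk hx hd h m
      rw [stateAfter, step_pos hJ (h1.isClosest_right hx hd (h2 J hJ)),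
        Function.update_of_ne hne]
      exact ih (by omega)
  rw [← hpos _ hnm le_rfl]
  refine lt_of_le_of_lt ?_ ((originSpared_of_mem hk hx hd h _).2 j hm)
  exact hd.monotone (Nat.succ_le_succ hnm)

/-- If the origin survives, there are at least `k` particles between `x` and `2x`, at least `2k`
between `x` and `4x`, and so on. -/
theorem startAndDust_le_of_mem (hk : 0 < k) (hx : 0 < x) (hd : StrictMono (startAndDust x d))
    (hr : ∀ j, Filter.Tendsto (r j) Filter.atTop Filter.atTop)
    (h : ∀ n, 0 ∈ (stateAfter x d r n).present) (q : ℕ) :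
    startAndDust x d (k * q) ≤ 2 ^ q * x := by
  induction q with
  | zero => simp [startAndDust]
  | succ q ih =>
    choose J hJ using fun n => exists_isNextRinger hk r (stateAfter x d r n)
    -- `k - 1` rings leave at least one worker in place
    obtain ⟨w, hw⟩ : ∃ w, ∀ l < k - 1, J (k * q + l) ≠ w := by
      by_contra! hall
      have h1 : (Finset.univ : Finset (Fin k)) ⊆
          (Finset.range (k - 1)).image fun l => J (k * q + l) := by
        intro w _
        obtain ⟨l, hl, e⟩ := hall w
        exact Finset.mem_image.2 ⟨l, Finset.mem_range.2 hl, e⟩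
      have h2 := (Finset.card_le_card h1).trans Finset.card_image_le
      rw [Finset.card_univ, Fintype.card_fin, Finset.card_range] at h2
      omega
    have hpos : ∀ l ≤ k - 1, (stateAfter x d r (k * q + l)).pos w =
        (stateAfter x d r (k * q)).pos w := by
      intro l
      induction l with
      | zero => intro _; rfl
      | succ l ihl =>
        intro hl
        obtain ⟨h1, h2⟩ := originSpared_of_mem hk hx hd h (k * q + l)
        rw [← add_assoc, stateAfter,
          step_pos (hJ _) (h1.isClosest_right hx hd (h2 _ (hJ _))),
          Function.update_of_ne (hw l (by omega)).symm]
        exact ihl (by omega)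
    have h1 := lt_two_mul_pos hk hx hd hr h (k * q + (k - 1)) w
    rw [hpos _ le_rfl] at h1
    have h2 := (originSpared_of_mem hk hx hd h (k * q)).1.pos_le w
    have h3 : k * (q + 1) = k * q + (k - 1) + 1 := by
      rw [mul_add, mul_one]; omega
    rw [h3, pow_succ]
    show d _ ≤ _
    linarith

end Dynamics

/-! ### A deterministic strategy for survival -/

/-- A sequence of positive spacings whose partial sums grow like those of the constant sequence
`1`, up to a relative error `1 / 10` and an absolute error `C`. -/
def IsRegular (C : ℝ) (s : ℕ → ℝ) : Prop :=
  (∀ i, 0 < s i) ∧ ∀ n : ℕ, |∑ i ∈ Finset.range n, s i - n| ≤ n / 10 + C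

/-- The lower end of the window prescribed for the `i`-th dust spacing. Only the first of each
round of `k` spacings is long; it multiplies the distance to the origin by about `ρ`. -/
noncomputable def dustWindowStart (k : ℕ) (x ρ : ℝ) (i : ℕ) : ℝ :=
  if k ∣ i then (ρ - 1) * ρ ^ (i / k) * x else 0

/-- The length of the window prescribed for the `i`-th dust spacing. The factor `(2 / ρ - 1) / k`
keeps the particles of round `q` below `2 * ρ ^ q * x`, even when all the errors add up. -/
noncomputable def dustWindowLength (k : ℕ) (x ρ : ℝ) (i : ℕ) : ℝ :=
  (2 / ρ - 1) / k * ((ρ - 1) * ρ ^ (i / k) * x)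

/-- The lower end of the window prescribed for the `i`-th spacing of the clock of worker `j`. -/
noncomputable def clockWindowStart (k j i : ℕ) : ℝ := 1 + if i = 0 then (j : ℝ) / k else 0

/-- The length of the window prescribed for the spacings of the clocks in the first `N + 1`
rounds; it is so short that the errors never add up to more than `1 / k`. -/
noncomputable def clockWindowLength (k N : ℕ) : ℝ := 1 / (k * (N + 1))

section Strategy

variable {k N : ℕ} {x ρ C : ℝ} {d s : ℕ → ℝ} {r u : Fin k → ℕ → ℝ}

theorem clock_mem_window (hk : 0 < k) (hru : ∀ j n, r j n = ∑ i ∈ Finset.range (n + 1), u j i)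
    (hu : ∀ j : Fin k, ∀ i < N + 1, u j i ∈ Set.Ioo (clockWindowStart k j i)
      (clockWindowStart k j i + clockWindowLength k N)) (j : Fin k) {n : ℕ} (hn : n ≤ N) :
    r j n ∈ Set.Ioo (n + 1 + (j : ℝ) / k) (n + 1 + ((j : ℝ) + 1) / k) := by
  have hk' : (0 : ℝ) < k := by exact_mod_cast hk
  have key : r j n ∈ Set.Ioo (n + 1 + (j : ℝ) / k)
      (n + 1 + (j : ℝ) / k + (n + 1) * clockWindowLength k N) := by
    induction n with
    | zero =>
      have := hu j 0 (by omega)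
      rw [hru]
      simpa [clockWindowStart] using this
    | succ n ih =>
      have h1 := ih (by omega)
      have h2 := hu j (n + 1) (by omega)
      rw [hru] at h1 ⊢
      rw [Finset.sum_range_succ]
      simp only [clockWindowStart, Nat.succ_ne_zero, if_false, Set.mem_Ioo] at h1 h2 ⊢
      push_cast
      constructor <;> linarith
  refine ⟨key.1, key.2.trans_le ?_⟩
  have h1 : ((n : ℝ) + 1) * clockWindowLength k N ≤ 1 / k := by
    have hn' : (n : ℝ) ≤ N := by exact_mod_cast hn
    rw [clockWindowLength, mul_one_div, div_le_div_iff₀ (by positivity) hk']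
    nlinarith
  rw [add_div]
  linarith

/-- If the clocks ring in turn during the first `N` rounds, the workers advance in turn. -/
theorem rings_of_clock_windows (hk : 0 < k)
    (hr : ∀ j : Fin k, ∀ n ≤ N, r j n ∈ Set.Ioo (n + 1 + (j : ℝ) / k) (n + 1 + ((j : ℝ) + 1) / k))
    {q : ℕ} (hq : q ≤ N) :
    (∀ i, (stateAfter x d r (k * q)).rings i = q) ∧
      (q < N → ∀ l (hl : l < k), IsNextRinger r (stateAfter x d r (k * q + l)) ⟨l, hl⟩ ∧
        (stateAfter x d r (k * q + l)).rings ⟨l, hl⟩ = q) := by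
  have hk' : (0 : ℝ) < k := by exact_mod_cast hk
  -- who rings, given that the workers below `l` have completed the current round
  have hnext : ∀ q < N, ∀ l (hl : l < k), (∀ i : Fin k,
      (stateAfter x d r (k * q + l)).rings i = if (i : ℕ) < l then q + 1 else q) →
      IsNextRinger r (stateAfter x d r (k * q + l)) ⟨l, hl⟩ := by
    intro q hq l hl hc i
    rw [hc ⟨l, hl⟩, hc i]
    have h1 := (hr ⟨l, hl⟩ q hq.le).2
    simp only [lt_irrefl, if_false] at h1 ⊢
    have hl1 : ((l : ℝ) + 1) / k ≤ 1 := by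
      rw [div_le_one hk']
      exact_mod_cast hl
    split_ifs with h
    · left
      have h2 := (hr i (q + 1) hq).1
      have : (0 : ℝ) ≤ (i : ℕ) / (k : ℝ) := by positivity
      push_cast at h2
      linarith
    · rcases (not_lt.1 h).eq_or_lt with h | h
      · right
        have : (⟨l, hl⟩ : Fin k) = i := Fin.ext h
        simp [this]
      · left
        have h2 := (hr i q hq.le).1
        have : ((l : ℝ) + 1) / k ≤ (i : ℕ) / (k : ℝ) := by
          rw [div_le_div_iff_of_pos_right hk']
          exact_mod_cast h
        linarith
  have hround : ∀ q < N, (∀ i, (stateAfter x d r (k * q)).rings i = q) → ∀ l ≤ k, ∀ i : Fin k,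
      (stateAfter x d r (k * q + l)).rings i = if (i : ℕ) < l then q + 1 else q := by
    intro q hq h0 l
    induction l with
    | zero => intro _ i; simpa using h0 i
    | succ l ih =>
      intro hl i
      have ih := ih (by omega)
      have hJ := hnext q hq l hl ih
      rw [← add_assoc, rings_succ hJ]
      by_cases hi : i = ⟨l, hl⟩
      · subst hi
        simp [ih]
      · have hi' : (i : ℕ) ≠ l := fun h => hi (Fin.ext h)
        rw [Function.update_of_ne hi, ih]
        split_ifs <;> omega
  have hall : ∀ q ≤ N, ∀ i, (stateAfter x d r (k * q)).rings i = q := by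
    intro q
    induction q with
    | zero => intro _ i; rfl
    | succ q ih =>
      intro hq i
      have := hround q hq (ih (by omega)) k le_rfl i
      simpa [mul_add] using this
  refine ⟨hall q hq, fun hq' l hl => ?_⟩
  have h1 := hround q hq' (hall q hq) l hl.le
  exact ⟨hnext q hq' l hl h1, by simp [h1]⟩

/-- If the dust spacings of the first `N` rounds lie in their windows, the particles of round `q`
lie between `ρ ^ (q + 1) * x` and `2 * ρ ^ q * x`. -/
theorem dust_of_windows (hk : 0 < k) (hx : 0 < x) (hρ : 1 < ρ) (hρ2 : ρ < 2)
    (hds : ∀ n, startAndDust x d n = x + ∑ i ∈ Finset.range n, s i)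
    (hs : ∀ i < k * N, s i ∈ Set.Ioo (dustWindowStart k x ρ i)
      (dustWindowStart k x ρ i + dustWindowLength k x ρ i)) {q : ℕ} (hq : q ≤ N) :
    ρ ^ q * x ≤ startAndDust x d (k * q) ∧ startAndDust x d (k * q) ≤ 2 / ρ * (ρ ^ q * x) ∧
      (q < N → ∀ l < k, ρ ^ (q + 1) * x ≤ d (k * q + l) ∧ d (k * q + l) < 2 * (ρ ^ q * x)) := by
  have hk' : (0 : ℝ) < k := by exact_mod_cast hk
  have hρ0 : 0 < ρ := by linarith
  set κ := 2 / ρ - 1 with hκ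
  have hκ0 : 0 < κ := by
    rw [hκ, sub_pos, one_lt_div hρ0]
    exact hρ2
  have hκρ : ρ * (1 + κ) = 2 := by rw [hκ]; field_simp; ring
  have hsucc : ∀ n, startAndDust x d (n + 1) = startAndDust x d n + s n := fun n => by
    rw [hds, hds, Finset.sum_range_succ, add_assoc]
  -- one round of `k` spacings
  have hround : ∀ q < N, ∀ l < k,
      (ρ - 1) * ρ ^ q * x < startAndDust x d (k * q + l + 1) - startAndDust x d (k * q) ∧
      startAndDust x d (k * q + l + 1) - startAndDust x d (k * q) <
        (ρ - 1) * ρ ^ q * x + (l + 1) * (κ / k * ((ρ - 1) * ρ ^ q * x)) := by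
    intro q hq l hl
    have hlt : ∀ l < k, k * q + l < k * N := by
      intro l hl
      have : k * (q + 1) ≤ k * N := Nat.mul_le_mul_left k hq
      rw [mul_add] at this
      omega
    have hdiv : ∀ l < k, (k * q + l) / k = q := fun l hl => by
      rw [Nat.mul_add_div hk, Nat.div_eq_of_lt hl, add_zero]
    induction l with
    | zero =>
      have h1 := hs (k * q + 0) (hlt 0 hk)
      rw [dustWindowStart, dustWindowLength, hdiv 0 hk, if_pos (by simp)] at h1
      rw [hsucc]
      simp only [add_zero, add_sub_cancel_left, Nat.cast_zero, zero_add, one_mul, Set.mem_Ioo]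
        at h1 ⊢
      exact h1
    | succ l ih =>
      have h1 := hs (k * q + (l + 1)) (hlt _ hl)
      have hnd : ¬ k ∣ k * q + (l + 1) := by
        rw [Nat.dvd_add_right (dvd_mul_right k q)]
        exact Nat.not_dvd_of_pos_of_lt (Nat.succ_pos l) hl
      rw [dustWindowStart, dustWindowLength, hdiv _ hl, if_neg hnd, ← hκ] at h1
      have h2 := ih (by omega)
      rw [hsucc (k * q + (l + 1)), ← add_assoc]
      rw [← add_assoc] at h1
      push_cast
      constructor <;> linarith [h1.1, h1.2, h2.1, h2.2]
  have hround' : ∀ q < N, ∀ l < k,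
      startAndDust x d (k * q + l + 1) - startAndDust x d (k * q) <
        (1 + κ) * ((ρ - 1) * ρ ^ q * x) := by
    intro q hq l hl
    refine (hround q hq l hl).2.trans_le ?_
    have h1 : ((l : ℝ) + 1) * (κ / k) ≤ κ := by
      rw [mul_div_assoc', div_le_iff₀ hk', mul_comm]
      have : (l : ℝ) + 1 ≤ k := by exact_mod_cast hl
      exact mul_le_mul_of_nonneg_left this hκ0.le
    have h2 : 0 ≤ (ρ - 1) * ρ ^ q * x := by
      have : 0 < ρ - 1 := by linarith
      positivity
    nlinarith
  have hends : ∀ q ≤ N, ρ ^ q * x ≤ startAndDust x d (k * q) ∧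
      startAndDust x d (k * q) ≤ ρ ^ q * x + κ * ((ρ ^ q - 1) * x) := by
    intro q
    induction q with
    | zero => intro _; simp [startAndDust]
    | succ q ih =>
      intro hq
      have h1 := ih (by omega)
      have h2 := hround q hq (k - 1) (by omega)
      have h3 := hround' q hq (k - 1) (by omega)
      have h4 : k * q + (k - 1) + 1 = k * (q + 1) := by rw [mul_add]; omega
      rw [h4] at h2 h3
      rw [pow_succ]
      constructor
      · linarith [h1.1, h2.1]
      · linarith [h1.2]
  have hends' : ∀ q ≤ N, startAndDust x d (k * q) ≤ (1 + κ) * (ρ ^ q * x) := by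
    intro q hq
    have := (hends q hq).2
    nlinarith [mul_pos hκ0 hx]
  refine ⟨(hends q hq).1, ?_, fun hq' l hl => ?_⟩
  · have := hends' q hq
    have e : 1 + κ = 2 / ρ := by rw [hκ]; ring
    rwa [e] at this
  · have h1 := (hround q hq' l hl).1
    have h2 := hround' q hq' l hl
    have h3 := hends q hq
    have e : startAndDust x d (k * q + l + 1) = d (k * q + l) := rfl
    rw [e] at h1 h2
    have h4 := mul_pos hκ0 hx
    have h5 : (1 + κ) * ((ρ - 1) * ρ ^ q * x) = 2 * (ρ ^ q * x) - (1 + κ) * (ρ ^ q * x) := by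
      rw [← hκρ]; ring
    rw [pow_succ]
    constructor
    · linarith [h3.1]
    · linarith [h3.2]

/-- If the clocks are regular from round `N + 1` on, the numbers of rings of two workers stay
comparable. -/
theorem rings_balanced (hk : 0 < k)
    (hrmono : ∀ j, Monotone (r j))
    (hr : ∀ j : Fin k, r j N ∈ Set.Icc ((N : ℝ) + 1) (N + 2))
    (hreg : ∀ j : Fin k, ∀ m : ℕ, |r j (N + m) - r j N - m| ≤ m / 10 + C)
    {n : ℕ} (hn : ∀ i, N ≤ (stateAfter x d r n).rings i) (i j : Fin k) :
    9 / 10 * (((stateAfter x d r n).rings i : ℝ) - N) ≤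
      11 / 10 * (((stateAfter x d r n).rings j : ℝ) - N) + 2 * C + 2 := by
  have hC : 0 ≤ C := by simpa using hreg i 0
  obtain ⟨a, ha⟩ := Nat.exists_eq_add_of_le (hn i)
  obtain ⟨b, hb⟩ := Nat.exists_eq_add_of_le (hn j)
  rw [ha, hb]
  push_cast
  have hb0 : (0 : ℝ) ≤ b := b.cast_nonneg
  cases a with
  | zero => simp only [Nat.cast_zero]; linarith
  | succ a =>
    have h1 := past_ring_le_pending hk hrmono n i j (N + a) (by rw [ha]; rfl)
    rw [hb] at h1
    have h2 := abs_le.1 (hreg i a)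
    have h3 := abs_le.1 (hreg j b)
    have h4 := (hr i).1
    have h5 := (hr j).2
    push_cast
    linarith [h2.1, h3.2]

/-- The strategy: in each of the first `N` rounds every worker advances once and the distance to
the origin grows by a factor of about `ρ < 2`; afterwards everything is so far from the origin
that it is safe as long as dust and clocks are regular. -/
theorem mem_present_of_windows (hk : 0 < k) (hx : 0 < x) (hρ : 1 < ρ) (hρ2 : ρ < 2)
    (hds : ∀ n, startAndDust x d n = x + ∑ i ∈ Finset.range n, s i)
    (hru : ∀ j n, r j n = ∑ i ∈ Finset.range (n + 1), u j i)
    (hs : ∀ i < k * N, s i ∈ Set.Ioo (dustWindowStart k x ρ i)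
      (dustWindowStart k x ρ i + dustWindowLength k x ρ i))
    (hu : ∀ j : Fin k, ∀ i < N + 1, u j i ∈ Set.Ioo (clockWindowStart k j i)
      (clockWindowStart k j i + clockWindowLength k N))
    (hsreg : IsRegular C fun i => s (k * N + i))
    (hureg : ∀ j, IsRegular C fun i => u j (N + 1 + i))
    (hN : 12 * k * (C + 1) ≤ (2 - 2 / ρ) * (ρ ^ N * x)) (n : ℕ) :
    0 ∈ (stateAfter x d r n).present := by
  have hk' : (1 : ℝ) ≤ k := by exact_mod_cast hk
  have hC : 0 ≤ C := by simpa using hsreg.2 0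
  have hρ0 : 0 < ρ - 1 := by linarith
  have hs0 : ∀ i, 0 < s i := by
    intro i
    rcases lt_or_ge i (k * N) with h | h
    · refine lt_of_le_of_lt ?_ (hs i h).1
      rw [dustWindowStart]
      split_ifs
      · positivity
      · exact le_rfl
    · obtain ⟨m, rfl⟩ := Nat.exists_eq_add_of_le h
      exact hsreg.1 m
  have hd : StrictMono (startAndDust x d) := strictMono_nat_of_lt_succ fun n => by
    rw [hds, hds, Finset.sum_range_succ]
    linarith [hs0 n]
  have hu0 : ∀ j i, 0 < u j i := by
    intro j i
    rcases lt_or_ge i (N + 1) with h | h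
    · refine lt_of_lt_of_le ?_ (hu j i h).1.le
      rw [clockWindowStart]
      split_ifs <;> positivity
    · obtain ⟨m, rfl⟩ := Nat.exists_eq_add_of_le h
      exact (hureg j).1 m
  have hrmono : ∀ j, Monotone (r j) := fun j => monotone_nat_of_le_succ fun n => by
    rw [hru, hru, Finset.sum_range_succ _ (n + 1)]
    linarith [hu0 j (n + 1)]
  have hwin : ∀ j : Fin k, ∀ n ≤ N,
      r j n ∈ Set.Ioo (n + 1 + (j : ℝ) / k) (n + 1 + ((j : ℝ) + 1) / k) :=
    fun j n hn => clock_mem_window hk hru hu j hn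
  have hrN : ∀ j : Fin k, r j N ∈ Set.Icc ((N : ℝ) + 1) (N + 2) := by
    intro j
    have h1 := hwin j N le_rfl
    have h2 : (0 : ℝ) ≤ (j : ℝ) / k := by positivity
    have h3 : ((j : ℝ) + 1) / k ≤ 1 := by
      rw [div_le_one (by linarith)]
      exact_mod_cast j.2
    constructor <;> linarith [h1.1, h1.2]
  have hreg : ∀ j : Fin k, ∀ m : ℕ, |r j (N + m) - r j N - m| ≤ m / 10 + C := by
    intro j m
    have := (hureg j).2 m
    rwa [show r j (N + m) - r j N = ∑ i ∈ Finset.range m, u j (N + 1 + i) by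
      rw [hru, hru, show N + m + 1 = N + 1 + m by ring, Finset.sum_range_add]; ring]
  set Y := ρ ^ N * x with hY
  set B : ℕ → ℝ := fun m =>
    if m < N then ρ ^ m * x else Y + 7 / 10 * (k * ((m : ℝ) - N)) - 4 * (k * (C + 1)) with hB
  have hkC : 0 ≤ (k : ℝ) * (C + 1) := by positivity
  have hBle : ∀ m ≤ N, B m ≤ ρ ^ m * x := by
    intro m hm
    rw [hB]
    dsimp only
    split_ifs with h
    · exact le_rfl
    · obtain rfl : m = N := by omega
      rw [hY]
      linarith
  refine mem_present_of_bound hk hx hd B (by simpa using hBle 0 (by omega)) (fun n J hJ => ?_) n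
  rcases lt_or_ge n (k * N) with hn | hn
  · have hq : n / k < N := Nat.div_lt_of_lt_mul hn
    have hl : n % k < k := Nat.mod_lt _ hk
    obtain ⟨h1, h2⟩ := (rings_of_clock_windows (x := x) (d := d) hk hwin hq.le).2 hq _ hl
    obtain ⟨h3, h4⟩ := (dust_of_windows hk hx hρ hρ2 hds hs hq.le).2.2 hq _ hl
    rw [Nat.div_add_mod] at h1 h2 h3 h4
    rw [hJ.unique h1, h2]
    refine ⟨(hBle _ hq).trans h3, ?_⟩
    rw [hB]
    dsimp only
    rwa [if_pos hq]
  · have h0 := (rings_of_clock_windows (x := x) (d := d) hk hwin le_rfl).1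
    have hge : ∀ i, N ≤ (stateAfter x d r n).rings i := fun i => by
      rw [← h0 i]
      exact rings_mono hk i hn
    have hbal := rings_balanced hk hrmono hrN hreg hge
    obtain ⟨m, rfl⟩ := Nat.exists_eq_add_of_le hn
    set c := (stateAfter x d r (k * N + m)).rings with hc
    -- the number of rings since the end of the first phase
    have hm : (m : ℝ) = ∑ i, ((c i : ℝ) - N) := by
      have : ((∑ i, c i : ℕ) : ℝ) = ((k * N + m : ℕ) : ℝ) := by rw [sum_rings hk]
      push_cast at this
      rw [Finset.sum_sub_distrib, this]
      simp
    have hm1 : 9 / 10 * (m : ℝ) ≤ k * (11 / 10 * ((c J : ℝ) - N) + 2 * C + 2) := by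
      rw [hm, Finset.mul_sum]
      refine (Finset.sum_le_card_nsmul _ _ _ fun i _ => hbal i J).trans_eq ?_
      rw [Finset.card_univ, Fintype.card_fin, nsmul_eq_mul]
    have hm2 : (k : ℝ) * (9 / 10 * ((c J : ℝ) - N) - 2 * C - 2) ≤ 11 / 10 * m := by
      rw [hm, Finset.mul_sum]
      refine le_trans ?_ (Finset.card_nsmul_le_sum _ _ (9 / 10 * ((c J : ℝ) - N) - 2 * C - 2)
        fun i _ => ?_)
      · simp
      · linarith [hbal J i]
    obtain ⟨h1, h2, -⟩ := dust_of_windows hk hx hρ hρ2 hds hs (le_refl N)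
    have h3 := abs_le.1 (hsreg.2 (m + 1))
    have h4 : d (k * N + m) =
        startAndDust x d (k * N) + ∑ i ∈ Finset.range (m + 1), s (k * N + i) := by
      change startAndDust x d (k * N + m + 1) = _
      rw [hds, hds, add_assoc (k * N), Finset.sum_range_add]
      ring
    push_cast at h3
    have he : 0 ≤ (k : ℝ) * ((c J : ℝ) - N) := by
      have : (N : ℝ) ≤ c J := by exact_mod_cast hge J
      exact mul_nonneg (by linarith) (by linarith)
    have hkC2 : (C : ℝ) + 1 ≤ k * (C + 1) := by nlinarith
    have hkC3 : (k : ℝ) ≤ k * (C + 1) := by nlinarith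
    rw [hB]
    dsimp only
    rw [if_neg (by have := hge J; omega), if_neg (by have := hge J; omega), h4]
    push_cast
    constructor
    · nlinarith [h3.1]
    · nlinarith [h3.2]

end Strategy

/-! ### The exponential distribution -/

instance : IsProbabilityMeasure (expMeasure 1) := isProbabilityMeasure_expMeasure one_pos

theorem expMeasure_real_Iic {a : ℝ} (ha : 0 ≤ a) :
    (expMeasure 1).real (Set.Iic a) = 1 - Real.exp (-a) := by
  rw [← cdf_eq_real, cdf_expMeasure_eq one_pos, if_pos ha, one_mul]

theorem expMeasure_real_Iio_le {a : ℝ} (ha : 0 ≤ a) : (expMeasure 1).real (Set.Iio a) ≤ a := by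
  refine (measureReal_mono Set.Iio_subset_Iic_self).trans ?_
  rw [expMeasure_real_Iic ha]
  linarith [Real.one_sub_le_exp_neg a]

instance : NullSingletonClass (expMeasure 1) := nullSingletonClass_withDensity _

theorem le_expMeasure_real_Ioo {a w : ℝ} (ha : 0 ≤ a) (hw : 0 ≤ w) :
    w * Real.exp (-(a + w)) ≤ (expMeasure 1).real (Set.Ioo a (a + w)) := by
  have h1 : (expMeasure 1).real (Set.Ioo a (a + w)) = Real.exp (-a) - Real.exp (-(a + w)) := by
    rw [measureReal_congr Ioo_ae_eq_Ioc, ← Set.Iic_sdiff_Iic,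
      measureReal_sdiff (Set.Iic_subset_Iic.2 (by linarith)) measurableSet_Iic,
      expMeasure_real_Iic ha, expMeasure_real_Iic (by linarith)]
    ring
  rw [h1, show -a = w + -(a + w) by ring, Real.exp_add]
  have := Real.add_one_le_exp w
  have h2 := Real.exp_pos (-(a + w))
  nlinarith

theorem ae_pos_expMeasure : ∀ᵐ y ∂expMeasure 1, 0 < y := by
  have h : (expMeasure 1).real (Set.Iic 0) = 0 := by simp [expMeasure_real_Iic le_rfl]
  rw [measureReal_eq_zero_iff] at h
  rw [ae_iff]
  simpa [Set.Iic_def] using h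

theorem integrable_and_integral_id_expMeasure :
    Integrable (fun y => y) (expMeasure 1) ∧ ∫ y, y ∂expMeasure 1 = 1 := by
  have hmeas : Measurable (gammaPDF 1 1) := (measurable_gammaPDFReal 1 1).ennreal_ofReal
  have hfin : ∀ᵐ y ∂(volume : Measure ℝ), gammaPDF 1 1 y < ⊤ :=
    Filter.Eventually.of_forall fun _ => ENNReal.ofReal_lt_top
  have heq : (fun y : ℝ => (gammaPDF 1 1 y).toReal • y) =ᵐ[volume]
      (Set.Ioi 0).indicator fun y => Real.exp (-y) * y ^ ((2 : ℝ) - 1) := by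
    refine Filter.Eventually.of_forall fun y => ?_
    dsimp only
    rw [gammaPDF, gammaPDFReal, Set.indicator]
    norm_num
    rcases lt_trichotomy y 0 with h | h | h
    · simp [h.not_ge, h.not_gt]
    · simp [h]
    · simp [h, h.le, (Real.exp_pos _).le]
  have hint := Real.GammaIntegral_convergent (s := 2) two_pos
  constructor
  · rw [expMeasure, gammaMeasure, integrable_withDensity_iff_integrable_smul' hmeas hfin,
      integrable_congr heq, integrable_indicator_iff measurableSet_Ioi]
    exact hint
  · rw [expMeasure, gammaMeasure, integral_withDensity_eq_integral_toReal_smul hmeas hfin,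
      integral_congr_ae heq, integral_indicator measurableSet_Ioi,
      ← Real.Gamma_eq_integral two_pos, Real.Gamma_two]

/-! ### The law of the spacings -/

/-- The law of a sequence of independent exponential random variables, that is, of the spacings
of a rate-1 Poisson process. -/
noncomputable def spacingLaw : Measure (ℕ → ℝ) := Measure.infinitePi fun _ => expMeasure 1

instance : IsProbabilityMeasure spacingLaw := by
  rw [spacingLaw]; infer_instance

theorem iIndepFun_eval_spacingLaw : iIndepFun (fun (i : ℕ) (s : ℕ → ℝ) => s i) spacingLaw :=
  iIndepFun_infinitePi (X := fun _ y => y) (by fun_prop)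

theorem measurePreserving_eval_spacingLaw (i : ℕ) :
    MeasurePreserving (fun s : ℕ → ℝ => s i) spacingLaw (expMeasure 1) :=
  measurePreserving_eval_infinitePi _ i

theorem measurePreserving_shift_spacingLaw (n : ℕ) :
    MeasurePreserving (fun (s : ℕ → ℝ) i => s (n + i)) spacingLaw spacingLaw :=
  ⟨by fun_prop, Measure.map_infinitePi_infinitePi_of_inj (add_right_injective n)⟩

theorem ae_pos_spacingLaw : ∀ᵐ s : ℕ → ℝ ∂spacingLaw, ∀ i, 0 < s i :=
  ae_all_iff.2 fun i =>
    (measurePreserving_eval_spacingLaw i).quasiMeasurePreserving.ae ae_pos_expMeasure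

theorem strong_law_spacingLaw : ∀ᵐ s : ℕ → ℝ ∂spacingLaw,
    Filter.Tendsto (fun n : ℕ => (∑ i ∈ Finset.range n, s i) / n) Filter.atTop (nhds 1) := by
  have hmp := measurePreserving_eval_spacingLaw
  have h := strong_law_ae_real (μ := spacingLaw) (fun (i : ℕ) (s : ℕ → ℝ) => s i)
    ((hmp 0).integrable_comp_of_integrable integrable_and_integral_id_expMeasure.1)
    (fun i j hij => iIndepFun_eval_spacingLaw.indepFun hij)
    (fun i => ⟨(hmp i).aemeasurable, (hmp 0).aemeasurable, (hmp i).map_eq.trans (hmp 0).map_eq.symm⟩)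
  have e : ∫ s, s 0 ∂spacingLaw = 1 := by
    rw [← integrable_and_integral_id_expMeasure.2, ← (hmp 0).map_eq,
      integral_map (hmp 0).aemeasurable (f := fun y => y) aestronglyMeasurable_id]
  rwa [e] at h

theorem measurableSet_isRegular (C : ℝ) : MeasurableSet {s | IsRegular C s} := by
  have : {s | IsRegular C s} = (⋂ i : ℕ, {s : ℕ → ℝ | 0 < s i}) ∩
      ⋂ n : ℕ, {s : ℕ → ℝ | |∑ i ∈ Finset.range n, s i - n| ≤ n / 10 + C} := by
    ext s; simp [IsRegular]
  rw [this]
  refine (MeasurableSet.iInter fun i => measurableSet_lt measurable_const (by fun_prop)).inter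
    (MeasurableSet.iInter fun n => measurableSet_le ?_ measurable_const)
  have : Measurable fun s : ℕ → ℝ => ∑ i ∈ Finset.range n, s i - n := by fun_prop
  exact this.abs

theorem exists_isRegular_of_tendsto {s : ℕ → ℝ} (hpos : ∀ i, 0 < s i)
    (h : Filter.Tendsto (fun n : ℕ => (∑ i ∈ Finset.range n, s i) / n) Filter.atTop (nhds 1)) :
    ∃ m : ℕ, IsRegular m s := by
  obtain ⟨n₀, hn₀⟩ := Filter.eventually_atTop.1 (Metric.tendsto_nhds.1 h (1 / 10) (by norm_num))
  obtain ⟨m, hm⟩ := exists_nat_ge (∑ n ∈ Finset.range n₀, |∑ i ∈ Finset.range n, s i - n|)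
  refine ⟨m, hpos, fun n => ?_⟩
  rcases lt_or_ge n n₀ with hn | hn
  · have h1 := Finset.single_le_sum (f := fun n : ℕ => |∑ i ∈ Finset.range n, s i - (n : ℝ)|)
      (fun _ _ => abs_nonneg _) (Finset.mem_range.2 hn)
    have h2 : (0 : ℝ) ≤ n / 10 := by positivity
    linarith
  · rcases n.eq_zero_or_pos with rfl | hpos'
    · simp
    · have h1 := hn₀ n hn
      have hn' : (0 : ℝ) < n := by exact_mod_cast hpos'
      rw [Real.dist_eq, div_sub_one hn'.ne', abs_div, abs_of_pos hn', div_lt_iff₀ hn'] at h1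
      have h2 : (0 : ℝ) ≤ m := m.cast_nonneg
      linarith

theorem exists_half_le_isRegular :
    ∃ C : ℝ, 1 / 2 ≤ spacingLaw.real {s | IsRegular C s} := by
  have hmono : Monotone fun m : ℕ => {s | IsRegular (m : ℝ) s} := by
    intro a b hab s hs
    refine ⟨hs.1, fun n => (hs.2 n).trans ?_⟩
    have : (a : ℝ) ≤ b := by exact_mod_cast hab
    linarith
  have huniv : spacingLaw (⋃ m : ℕ, {s | IsRegular (m : ℝ) s}) = 1 := by
    rw [prob_compl_eq_zero_iff (MeasurableSet.iUnion fun m : ℕ => measurableSet_isRegular m) |>.symm]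
    change ∀ᵐ s : ℕ → ℝ ∂spacingLaw, s ∈ ⋃ m : ℕ, {s | IsRegular (m : ℝ) s}
    filter_upwards [ae_pos_spacingLaw, strong_law_spacingLaw] with s h1 h2
    simpa using exists_isRegular_of_tendsto h1 h2
  have ht := tendsto_measure_iUnion_atTop (μ := spacingLaw) hmono
  rw [huniv] at ht
  obtain ⟨m, hm⟩ := (ht.eventually_const_le (u := 1 / 2) (by norm_num)).exists
  refine ⟨m, ?_⟩
  have := ENNReal.toReal_mono (measure_ne_top _ _) hm
  simpa [measureReal_def] using this

theorem spacingLaw_real_pi (n : ℕ) {W : ℕ → Set ℝ} (hW : ∀ i, MeasurableSet (W i)) :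
    spacingLaw.real {s | ∀ i < n, s i ∈ W i} =
      ∏ i ∈ Finset.range n, (expMeasure 1).real (W i) := by
  have : {s : ℕ → ℝ | ∀ i < n, s i ∈ W i} = Set.pi (Finset.range n) W := by
    ext s; simp [Set.mem_pi]
  rw [this, measureReal_def, spacingLaw, Measure.infinitePi_pi _ fun i _ => hW i,
    ENNReal.toReal_prod]
  rfl

theorem measurableSet_windows (n : ℕ) {W : ℕ → Set ℝ} (hW : ∀ i, MeasurableSet (W i)) :
    MeasurableSet {s : ℕ → ℝ | ∀ i < n, s i ∈ W i} := by
  have : {s : ℕ → ℝ | ∀ i < n, s i ∈ W i} =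
      ⋂ i ∈ Finset.range n, (fun s : ℕ → ℝ => s i) ⁻¹' W i := by
    ext s; simp
  rw [this]
  exact Finset.measurableSet_biInter _ fun i _ => (measurable_pi_apply i) (hW i)

/-- The first `n` spacings are independent of the later ones, which have the same law as the whole
sequence. -/
theorem spacingLaw_real_windows_inter_shift (n : ℕ) {W : ℕ → Set ℝ}
    (hW : ∀ i, MeasurableSet (W i)) {G : Set (ℕ → ℝ)} (hG : MeasurableSet G) :
    spacingLaw.real {s | (∀ i < n, s i ∈ W i) ∧ (fun i => s (n + i)) ∈ G} =
      (∏ i ∈ Finset.range n, (expMeasure 1).real (W i)) * spacingLaw.real G := by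
  let m : ℕ → MeasurableSpace (ℕ → ℝ) := fun i =>
    MeasurableSpace.comap (fun s : ℕ → ℝ => s i) inferInstance
  have hind := indep_iSup_of_disjoint (m := m) (fun i => (measurable_pi_apply i).comap_le)
    iIndepFun_eval_spacingLaw.iIndep (S := {i | i < n}) (T := {i | n ≤ i})
    (Set.disjoint_left.2 fun i (hi : i < n) (hi' : n ≤ i) => by omega)
  have h1 : MeasurableSet[⨆ i ∈ {i | i < n}, m i] {s : ℕ → ℝ | ∀ i < n, s i ∈ W i} := by
    have : {s : ℕ → ℝ | ∀ i < n, s i ∈ W i} =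
        ⋂ i ∈ Finset.range n, (fun s : ℕ → ℝ => s i) ⁻¹' W i := by
      ext s; simp
    rw [this]
    refine Finset.measurableSet_biInter _ fun i hi => ?_
    have hle : m i ≤ ⨆ i ∈ {i | i < n}, m i := le_iSup₂_of_le i (Finset.mem_range.1 hi) le_rfl
    exact hle _ ⟨W i, hW i, rfl⟩
  have h2 : MeasurableSet[⨆ i ∈ {i | n ≤ i}, m i] ((fun (s : ℕ → ℝ) i => s (n + i)) ⁻¹' G) := by
    have hmeas : Measurable[⨆ i ∈ {i | n ≤ i}, m i] fun (s : ℕ → ℝ) i => s (n + i) := by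
      refine @measurable_pi_lambda _ _ _ (_) _ _ fun i => ?_
      have hle : m (n + i) ≤ ⨆ i ∈ {i | n ≤ i}, m i :=
        le_iSup₂_of_le (n + i) (show n ≤ n + i by omega) le_rfl
      exact (comap_measurable fun s : ℕ → ℝ => s (n + i)).mono hle le_rfl
    exact hmeas hG
  have h3 := (Indep_iff _ _ _).1 hind _ _ h1 h2
  have e : {s : ℕ → ℝ | (∀ i < n, s i ∈ W i) ∧ (fun i => s (n + i)) ∈ G} =
      {s | ∀ i < n, s i ∈ W i} ∩ (fun (s : ℕ → ℝ) i => s (n + i)) ⁻¹' G := rfl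
  rw [e, measureReal_def, h3, ENNReal.toReal_mul, ← measureReal_def, spacingLaw_real_pi n hW,
    (measurePreserving_shift_spacingLaw n).measure_preimage hG.nullMeasurableSet]
  rfl

/-- The probability that the first `n` spacings lie in prescribed windows and the later ones are
regular. -/
theorem le_spacingLaw_real_windows {C b : ℝ} (hC : 1 / 2 ≤ spacingLaw.real {s | IsRegular C s})
    (n : ℕ) {a w : ℕ → ℝ} (ha : ∀ i, 0 ≤ a i) (hw : ∀ i, 0 ≤ w i) (hb : ∀ i < n, a i + w i ≤ b) :
    (∏ i ∈ Finset.range n, w i * Real.exp (-b)) * (1 / 2) ≤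
      spacingLaw.real {s | (∀ i < n, s i ∈ Set.Ioo (a i) (a i + w i)) ∧
        IsRegular C fun i => s (n + i)} := by
  have h := spacingLaw_real_windows_inter_shift n (W := fun i => Set.Ioo (a i) (a i + w i))
    (fun _ => measurableSet_Ioo) (measurableSet_isRegular C)
  refine le_trans ?_ h.ge
  refine mul_le_mul (Finset.prod_le_prod (fun i _ => mul_nonneg (hw i) (Real.exp_pos _).le)
    fun i hi => ?_) hC (by norm_num) (Finset.prod_nonneg fun _ _ => measureReal_nonneg)
  refine le_trans ?_ (le_expMeasure_real_Ioo (ha i) (hw i))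
  exact mul_le_mul_of_nonneg_left (Real.exp_le_exp.2 (by linarith [hb i (Finset.mem_range.1 hi)]))
    (hw i)

theorem measurableSet_windows_inter_shift (n : ℕ) {W : ℕ → Set ℝ} (hW : ∀ i, MeasurableSet (W i))
    (C : ℝ) :
    MeasurableSet {s : ℕ → ℝ | (∀ i < n, s i ∈ W i) ∧ IsRegular C fun i => s (n + i)} :=
  (measurableSet_windows n hW).inter
    ((measurePreserving_shift_spacingLaw n).measurable (measurableSet_isRegular C))

/-! ### The randomness of the model -/

theorem sum_range_spacing {Ω : Type*} (a : ℝ) (T : ℕ → Ω → ℝ) (ω : Ω) (n : ℕ) :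
    ∑ i ∈ Finset.range n, spacing a T i ω = startAndDust a (fun i => T i ω) n - a := by
  induction n with
  | zero => simp [startAndDust]
  | succ n ih =>
    rw [Finset.sum_range_succ, ih]
    cases n <;> simp [spacing, startAndDust]

/-- The spacings depend on `ω` only through the sequence of points, so that they can be computed on
the space of sequences; this turns independence of the sequences into independence of the
spacings. -/
theorem spacing_eval {Ω : Type*} (a : ℝ) (T : ℕ → Ω → ℝ) (ω : Ω) :
    (fun n => spacing a (fun i (d : ℕ → ℝ) => d i) n fun i => T i ω) =
      fun n => spacing a T n ω := by
  funext n
  cases n <;> rfl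

theorem measurable_spacing_eval (a : ℝ) :
    Measurable fun (d : ℕ → ℝ) n => spacing a (fun i (d : ℕ → ℝ) => d i) n d := by
  refine measurable_pi_lambda _ fun n => ?_
  cases n <;> simp only [spacing] <;> fun_prop

section Model

variable {Ω : Type*} [MeasurableSpace Ω] {μ : Measure Ω}

theorem IsPoissonProcess.hasLaw_spacing {a : ℝ} {T : ℕ → Ω → ℝ} (h : IsPoissonProcess a T μ) :
    HasLaw (fun ω n => spacing a T n ω) spacingLaw μ :=
  h.spacing_indep.hasLaw_infinitePi h.spacing_law
    (aemeasurable_pi_lambda _ fun n => (h.spacing_law n).aemeasurable)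

variable {k : ℕ} {x : ℝ} {T : ℕ → Ω → ℝ} {R : Fin k → ℕ → Ω → ℝ}

theorem IsHalflineModel.measureReal_spacing_mem (h : IsHalflineModel k x T R μ)
    {E : Set (ℕ → ℝ)} {F : Fin k → Set (ℕ → ℝ)} (hE : MeasurableSet E)
    (hF : ∀ j, MeasurableSet (F j)) :
    μ.real {ω | (fun n => spacing x T n ω) ∈ E ∧ ∀ j, (fun n => spacing 0 (R j) n ω) ∈ F j} =
      spacingLaw.real E * ∏ j, spacingLaw.real (F j) := by
  let S : Option (Fin k) → Set Ω := fun o => o.elim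
    {ω | (fun n => spacing x T n ω) ∈ E} fun j => {ω | (fun n => spacing 0 (R j) n ω) ∈ F j}
  have hS : ∀ o, MeasurableSet[MeasurableSpace.comap (dustAndClocks T R o) inferInstance] (S o) := by
    rintro (_ | j)
    · refine ⟨_, measurable_spacing_eval x hE, ?_⟩
      ext ω
      simp only [dustAndClocks, Set.mem_preimage, spacing_eval]
      rfl
    · refine ⟨_, measurable_spacing_eval 0 (hF j), ?_⟩
      ext ω
      simp only [dustAndClocks, Set.mem_preimage, spacing_eval]
      rfl
  have h1 := h.indep.meas_iInter hS
  have e : {ω | (fun n => spacing x T n ω) ∈ E ∧ ∀ j, (fun n => spacing 0 (R j) n ω) ∈ F j} =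
      ⋂ o, S o := by
    ext ω
    simp [S, Set.mem_iInter, Option.forall]
  rw [e, measureReal_def, h1, Fintype.prod_option, ENNReal.toReal_mul, ENNReal.toReal_prod]
  congr 1
  · exact h.dust_poisson.hasLaw_spacing.measureReal_eq hE
  · exact Finset.prod_congr rfl fun j _ =>
      (h.clock_poisson j).hasLaw_spacing.measureReal_eq (hF j)

theorem IsPoissonProcess.ae_tendsto_atTop {T : ℕ → Ω → ℝ} (h : IsPoissonProcess 0 T μ) :
    ∀ᵐ ω ∂μ, Filter.Tendsto (fun n => T n ω) Filter.atTop Filter.atTop := by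
  have h1 : ∀ᵐ s : ℕ → ℝ ∂spacingLaw, ∃ m : ℕ, IsRegular m s := by
    filter_upwards [ae_pos_spacingLaw, strong_law_spacingLaw] with s h1 h2
    exact exists_isRegular_of_tendsto h1 h2
  rw [← h.hasLaw_spacing.map_eq] at h1
  filter_upwards [ae_of_ae_map h.hasLaw_spacing.aemeasurable h1] with ω ⟨m, hω⟩
  have h2 : ∀ n : ℕ, 9 / 10 * (n : ℝ) + -m ≤ T n ω := by
    intro n
    have h3 := (abs_le.1 (hω.2 (n + 1))).1
    rw [sum_range_spacing] at h3
    simp only [startAndDust] at h3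
    push_cast at h3
    linarith
  refine Filter.tendsto_atTop_mono h2 (Filter.tendsto_atTop_add_const_right _ _ ?_)
  exact tendsto_natCast_atTop_atTop.const_mul_atTop (by norm_num)

/-- An upper bound for the survival probability: for every `q`, the `k` spacings numbered
`k * q, …, k * q + k - 1` have to be smaller than `2 ^ (q + 1) * x`. -/
theorem IsHalflineModel.measureReal_originNeverRemoved_le (h : IsHalflineModel k x T R μ)
    (hk : 0 < k) (hx : 0 < x) (N : ℕ) :
    μ.real (originNeverRemoved x T R) ≤ ∏ i ∈ Finset.range (k * N), 2 ^ (i / k + 1) * x := by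
  have hprob := h.indep.isProbabilityMeasure
  have hlaw := h.dust_poisson.hasLaw_spacing
  set W : ℕ → Set ℝ := fun i => Set.Iio (2 ^ (i / k + 1) * x)
  have hW : ∀ i, MeasurableSet (W i) := fun i => measurableSet_Iio
  have hpos : ∀ᵐ ω ∂μ, ∀ i, 0 < spacing x T i ω := by
    have h1 := ae_pos_spacingLaw
    rw [← hlaw.map_eq] at h1
    exact ae_of_ae_map hlaw.aemeasurable h1
  have hsub : originNeverRemoved x T R ≤ᵐ[μ] {ω | ∀ i < k * N, spacing x T i ω ∈ W i} := by
    filter_upwards [hpos, ae_all_iff.2 fun j => (h.clock_poisson j).ae_tendsto_atTop]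
      with ω hω hR hsurv i _
    have hd' : ∀ n, startAndDust x (fun i => T i ω) (n + 1) =
        startAndDust x (fun i => T i ω) n + spacing x T n ω := by
      intro n
      have h1 := sum_range_spacing x T ω (n + 1)
      rw [Finset.sum_range_succ, sum_range_spacing] at h1
      linarith
    have hd : StrictMono (startAndDust x fun i => T i ω) := strictMono_nat_of_lt_succ fun n => by
      rw [hd']
      linarith [hω n]
    have h1 := startAndDust_le_of_mem hk hx hd hR hsurv (i / k + 1)
    have h2 : startAndDust x (fun i => T i ω) (i + 1) ≤
        startAndDust x (fun i => T i ω) (k * (i / k + 1)) :=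
      hd.monotone (Nat.lt_mul_div_succ i hk)
    have h3 : x ≤ startAndDust x (fun i => T i ω) i := hd.monotone i.zero_le
    have h4 := hd' i
    change spacing x T i ω < _
    linarith
  have h1 : μ.real (originNeverRemoved x T R) ≤
      μ.real {ω | ∀ i < k * N, spacing x T i ω ∈ W i} :=
    ENNReal.toReal_mono (measure_ne_top _ _) (measure_mono_ae hsub)
  refine h1.trans ?_
  rw [hlaw.measureReal_eq (p := fun s => ∀ i < k * N, s i ∈ W i)
    (measurableSet_windows _ hW), spacingLaw_real_pi _ hW]
  exact Finset.prod_le_prod (fun _ _ => measureReal_nonneg)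
    fun i _ => expMeasure_real_Iio_le (by positivity)

/-- A lower bound for the survival probability, from the strategy in which the workers advance
in turn and multiply their distance to the origin by about `ρ < 2` in each of the first `N`
rounds. -/
theorem IsHalflineModel.le_measureReal_originNeverRemoved (h : IsHalflineModel k x T R μ)
    (hk : 0 < k) (hx : 0 < x) {ρ C b : ℝ} (hρ : 1 < ρ) (hρ2 : ρ < 2)
    (hC : 1 / 2 ≤ spacingLaw.real {s | IsRegular C s}) {N : ℕ}
    (hN : 12 * k * (C + 1) ≤ (2 - 2 / ρ) * (ρ ^ N * x)) (hb : 2 * (ρ ^ N * x) ≤ b) :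
    (∏ i ∈ Finset.range (k * N), dustWindowLength k x ρ i * Real.exp (-b)) * (1 / 2) *
        ((clockWindowLength k N * Real.exp (-3)) ^ (N + 1) * (1 / 2)) ^ k ≤
      μ.real (originNeverRemoved x T R) := by
  have hprob := h.indep.isProbabilityMeasure
  have hk' : (1 : ℝ) ≤ k := by exact_mod_cast hk
  have hρ0 : 0 < ρ := by linarith
  have hρ1 : 0 < ρ - 1 := by linarith
  have hκ0 : 0 ≤ 2 / ρ - 1 := by
    rw [sub_nonneg, one_le_div hρ0]
    exact hρ2.le
  have hκ1 : 2 / ρ - 1 ≤ 1 := by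
    have : 2 / ρ ≤ 2 := (div_le_iff₀ hρ0).2 (by linarith)
    linarith
  have hpow : ∀ i, 0 ≤ (ρ - 1) * ρ ^ (i / k) * x := fun i => by positivity
  have ha : ∀ i, 0 ≤ dustWindowStart k x ρ i := fun i => by
    rw [dustWindowStart]
    split_ifs
    exacts [hpow i, le_rfl]
  have hw : ∀ i, 0 ≤ dustWindowLength k x ρ i := fun i =>
    mul_nonneg (div_nonneg hκ0 (by linarith)) (hpow i)
  have hab : ∀ i < k * N, dustWindowStart k x ρ i + dustWindowLength k x ρ i ≤ b := by
    intro i hi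
    have h1 : dustWindowStart k x ρ i ≤ (ρ - 1) * ρ ^ (i / k) * x := by
      rw [dustWindowStart]
      split_ifs
      exacts [le_rfl, hpow i]
    have h2 : dustWindowLength k x ρ i ≤ (ρ - 1) * ρ ^ (i / k) * x := by
      refine mul_le_of_le_one_left (hpow i) ?_
      rw [div_le_one (by linarith)]
      linarith
    have h3 : (ρ - 1) * ρ ^ (i / k) * x ≤ ρ ^ N * x := by
      refine mul_le_mul_of_nonneg_right ?_ hx.le
      have h4 : ρ ^ (i / k) ≤ ρ ^ N := pow_le_pow_right₀ hρ.le (Nat.div_lt_of_lt_mul hi).le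
      have h5 : 0 < ρ ^ (i / k) := by positivity
      nlinarith
    linarith
  have hca : ∀ (j : Fin k) i, 0 ≤ clockWindowStart k j i := fun j i => by
    rw [clockWindowStart]
    split_ifs <;> positivity
  have hcw : 0 ≤ clockWindowLength k N := by
    rw [clockWindowLength]; positivity
  have hcw1 : clockWindowLength k N ≤ 1 := by
    rw [clockWindowLength]
    refine div_le_one_of_le₀ ?_ (by positivity)
    have : (0 : ℝ) ≤ N := N.cast_nonneg
    nlinarith
  have hcab : ∀ (j : Fin k), ∀ i < N + 1, clockWindowStart k j i + clockWindowLength k N ≤ 3 := by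
    intro j i _
    have h1 : clockWindowStart k j i ≤ 2 := by
      rw [clockWindowStart]
      split_ifs
      · have : ((j : ℕ) : ℝ) / k ≤ 1 := by
          rw [div_le_one (by linarith)]
          exact_mod_cast j.2.le
        linarith
      · norm_num
    linarith
  have hdust := le_spacingLaw_real_windows hC (k * N) ha hw hab
  have hclock := fun j : Fin k =>
    le_spacingLaw_real_windows hC (N + 1) (hca j) (fun _ => hcw) (hcab j)
  simp only [Finset.prod_const, Finset.card_range] at hclock
  have hmeas := h.measureReal_spacing_mem
    (measurableSet_windows_inter_shift (k * N)
      (W := fun i => Set.Ioo (dustWindowStart k x ρ i)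
        (dustWindowStart k x ρ i + dustWindowLength k x ρ i)) (fun _ => measurableSet_Ioo) C)
    (fun j : Fin k => measurableSet_windows_inter_shift (N + 1)
      (W := fun i => Set.Ioo (clockWindowStart k j i)
        (clockWindowStart k j i + clockWindowLength k N)) (fun _ => measurableSet_Ioo) C)
  have hprod : ((clockWindowLength k N * Real.exp (-3)) ^ (N + 1) * (1 / 2)) ^ k =
      ∏ _j : Fin k, ((clockWindowLength k N * Real.exp (-3)) ^ (N + 1) * (1 / 2)) := by
    simp
  rw [hprod]
  refine (mul_le_mul hdust (Finset.prod_le_prod (fun j _ => by positivity) fun j _ => hclock j)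
    (Finset.prod_nonneg fun _ _ => by positivity) measureReal_nonneg).trans ?_
  rw [← hmeas]
  refine measureReal_mono ?_
  rintro ω ⟨⟨h1, h2⟩, h3⟩ n
  refine mem_present_of_windows (N := N) (C := C) (s := fun i => spacing x T i ω)
    (u := fun j i => spacing 0 (R j) i ω) hk hx hρ hρ2 (fun n => ?_) (fun j n => ?_) h1
    (fun j => (h3 j).1) h2 (fun j => (h3 j).2) hN n
  · rw [sum_range_spacing]
    ring
  · rw [sum_range_spacing]
    simp [startAndDust]

end Model

/-! ### Asymptotics of the bounds -/

theorem sum_range_mul_div {k : ℕ} (hk : 0 < k) (N : ℕ) (α β : ℝ) :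
    ∑ i ∈ Finset.range (k * N), (α + ((i / k : ℕ) : ℝ) * β) =
      k * (N * α + N * (N - 1) / 2 * β) := by
  induction N with
  | zero => simp
  | succ N ih =>
    have h : ∀ l ∈ Finset.range k, α + (((k * N + l) / k : ℕ) : ℝ) * β = α + N * β := by
      intro l hl
      rw [Nat.mul_add_div hk, Nat.div_eq_of_lt (Finset.mem_range.1 hl), add_zero]
    rw [mul_add, mul_one, Finset.sum_range_add, ih, Finset.sum_congr rfl h]
    simp only [Finset.sum_const, Finset.card_range, nsmul_eq_mul]
    push_cast
    ring

theorem log_prod_upper {k : ℕ} (hk : 0 < k) (N : ℕ) {x : ℝ} (hx : 0 < x) :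
    Real.log (∏ i ∈ Finset.range (k * N), 2 ^ (i / k + 1) * x) =
      k * (N * (Real.log 2 + Real.log x) + N * (N - 1) / 2 * Real.log 2) := by
  rw [Real.log_prod fun i _ => by positivity, ← sum_range_mul_div hk]
  refine Finset.sum_congr rfl fun i _ => ?_
  rw [Real.log_mul (by positivity) hx.ne', Real.log_pow]
  push_cast
  ring

theorem log_lower {k : ℕ} (hk : 0 < k) (N : ℕ) {x ρ b : ℝ} (hx : 0 < x) (hρ : 1 < ρ)
    (hρ2 : ρ < 2) :
    0 < (∏ i ∈ Finset.range (k * N), dustWindowLength k x ρ i * Real.exp (-b)) * (1 / 2) *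
        ((clockWindowLength k N * Real.exp (-3)) ^ (N + 1) * (1 / 2)) ^ k ∧
    Real.log ((∏ i ∈ Finset.range (k * N), dustWindowLength k x ρ i * Real.exp (-b)) * (1 / 2) *
        ((clockWindowLength k N * Real.exp (-3)) ^ (N + 1) * (1 / 2)) ^ k) =
      k * (N * (Real.log ((2 / ρ - 1) / k * (ρ - 1)) + Real.log x - b) +
        N * (N - 1) / 2 * Real.log ρ) + Real.log (1 / 2) +
      k * ((N + 1) * (-Real.log k - Real.log (N + 1) - 3) + Real.log (1 / 2)) := by
  have hk' : (0 : ℝ) < k := by exact_mod_cast hk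
  have hρ0 : 0 < ρ := by linarith
  have hρ1 : 0 < ρ - 1 := by linarith
  have hκ : 0 < 2 / ρ - 1 := by
    rw [sub_pos, one_lt_div hρ0]
    exact hρ2
  have hd : ∀ i, 0 < dustWindowLength k x ρ i := fun i => by
    rw [dustWindowLength]; positivity
  have hc : 0 < clockWindowLength k N := by
    rw [clockWindowLength]; positivity
  have hprod : 0 < ∏ i ∈ Finset.range (k * N), dustWindowLength k x ρ i * Real.exp (-b) :=
    Finset.prod_pos fun i _ => mul_pos (hd i) (Real.exp_pos _)
  refine ⟨by positivity, ?_⟩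
  rw [Real.log_mul (by positivity) (by positivity), Real.log_mul hprod.ne' (by norm_num),
    Real.log_pow, Real.log_mul (by positivity) (by norm_num), Real.log_pow,
    Real.log_mul hc.ne' (Real.exp_pos _).ne', Real.log_exp, clockWindowLength, one_div (_ * _),
    Real.log_inv, Real.log_mul hk'.ne' (by positivity),
    Real.log_prod fun i _ => (mul_pos (hd i) (Real.exp_pos _)).ne', ← sum_range_mul_div hk]
  congr 1
  · congr 1
    refine Finset.sum_congr rfl fun i _ => ?_
    rw [Real.log_mul (hd i).ne' (Real.exp_pos _).ne', Real.log_exp, dustWindowLength,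
      show (2 / ρ - 1) / k * ((ρ - 1) * ρ ^ (i / k) * x) =
        (2 / ρ - 1) / k * (ρ - 1) * ρ ^ (i / k) * x by ring,
      Real.log_mul (by positivity) hx.ne', Real.log_mul (by positivity) (by positivity),
      Real.log_pow]
    ring
  · push_cast
    ring

section Limits

open Filter Topology

/-- The quadratic terms: with `N ~ L / log ρ` rounds, `k * (-N * L + N ^ 2 / 2 * log ρ)` is about
`-k / (2 * log ρ) * L ^ 2`. -/
theorem tendsto_main_term (k : ℕ) {ρ : ℝ} (hρ : 1 < ρ) (c : ℝ) {N : ℝ → ℕ}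
    (hN : Tendsto (fun L => (N L : ℝ) / L) atTop (𝓝 (1 / Real.log ρ))) :
    Tendsto (fun L : ℝ => k * (N L * (c - L) + N L * (N L - 1) / 2 * Real.log ρ) / L ^ 2) atTop
      (𝓝 (-((k : ℝ) / (2 * Real.log ρ)))) := by
  have hl : 0 < Real.log ρ := Real.log_pos hρ
  have hinv : Tendsto (fun L : ℝ => 1 / L) atTop (𝓝 0) := by
    simpa using tendsto_inv_atTop_zero (𝕜 := ℝ)
  have h := (((hN.mul ((hinv.const_mul c).sub_const 1)).add
    (((hN.mul (hN.sub hinv)).div_const 2).mul_const (Real.log ρ))).const_mul (k : ℝ))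
  have e : (k : ℝ) * (1 / Real.log ρ * (c * 0 - 1) +
      1 / Real.log ρ * (1 / Real.log ρ - 0) / 2 * Real.log ρ) = -((k : ℝ) / (2 * Real.log ρ)) := by
    field_simp
    ring
  rw [e] at h
  refine h.congr' ?_
  filter_upwards [eventually_gt_atTop 0] with L hL
  field_simp

/-- The probability that the clocks ring in turn contributes only terms of order `L * log L`. -/
theorem tendsto_error_term (k : ℕ) (c₁ c₂ : ℝ) {a : ℝ} (ha : 0 < a) {N : ℝ → ℕ}
    (hN : Tendsto (fun L => (N L : ℝ) / L) atTop (𝓝 a)) :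
    Tendsto (fun L : ℝ => (c₁ + k * ((N L + 1) * (-Real.log k - Real.log (N L + 1) - 3) + c₂)) /
      L ^ 2) atTop (𝓝 0) := by
  have hinv : Tendsto (fun L : ℝ => 1 / L) atTop (𝓝 0) := by
    simpa using tendsto_inv_atTop_zero (𝕜 := ℝ)
  have hN1 : Tendsto (fun L => ((N L : ℝ) + 1) / L) atTop (𝓝 a) := by
    simpa [add_div] using hN.add hinv
  have hNtop : Tendsto (fun L => (N L : ℝ) + 1) atTop atTop := by
    refine (hN1.pos_mul_atTop ha tendsto_id).congr' ?_
    filter_upwards [eventually_gt_atTop 0] with L hL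
    simp [hL.ne']
  have hlog : Tendsto (fun L => Real.log ((N L : ℝ) + 1) / L) atTop (𝓝 0) := by
    have h1 : Tendsto (fun y : ℝ => Real.log y / y) atTop (𝓝 0) :=
      Real.isLittleO_log_id_atTop.tendsto_div_nhds_zero
    have h2 := (h1.comp hNtop).mul hN1
    rw [zero_mul] at h2
    refine h2.congr' ?_
    filter_upwards [eventually_gt_atTop 0] with L hL
    have : (0 : ℝ) < N L + 1 := by positivity
    simp only [Function.comp_apply]
    field_simp
  have h := ((hinv.mul hinv).const_mul c₁).add
    (((hN1.mul (((hinv.const_mul (-Real.log k)).sub hlog).sub (hinv.const_mul 3))).add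
      ((hinv.mul hinv).const_mul c₂)).const_mul (k : ℝ))
  simp only [mul_zero, sub_zero, add_zero] at h
  refine h.congr' ?_
  filter_upwards [eventually_gt_atTop 0] with L hL
  field_simp

theorem tendsto_neg_log_nhdsGT_zero : Tendsto (fun x : ℝ => -Real.log x) (𝓝[>] 0) atTop :=
  tendsto_neg_atBot_atTop.comp Real.tendsto_log_nhdsGT_zero

variable {k : ℕ} {Ω : ℝ → Type*} [∀ x, MeasurableSpace (Ω x)] {P : ∀ x, Measure (Ω x)}
  {T : ∀ x, ℕ → Ω x → ℝ} {R : ∀ x, Fin k → ℕ → Ω x → ℝ}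

theorem exists_lower_bound (hk : 0 < k)
    (hmodel : ∀ x, 0 < x → IsHalflineModel k x (T x) (R x) (P x)) {ρ : ℝ} (hρ : 1 < ρ)
    (hρ2 : ρ < 2) :
    ∃ l : ℝ → ℝ, Tendsto l (𝓝[>] 0) (𝓝 (-((k : ℝ) / (2 * Real.log ρ)))) ∧
      ∀ᶠ x in 𝓝[>] 0, 0 < (P x).real (originNeverRemoved x (T x) (R x)) ∧
        l x ≤ Real.log ((P x).real (originNeverRemoved x (T x) (R x))) / Real.log x ^ 2 := by
  have hl : 0 < Real.log ρ := Real.log_pos hρ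
  have hρ0 : 0 < ρ := by linarith
  obtain ⟨C, hC⟩ := exists_half_le_isRegular
  have hκ : 0 < 2 - 2 / ρ := by
    rw [sub_pos, div_lt_iff₀ hρ0]
    linarith
  obtain ⟨m, hm⟩ := pow_unbounded_of_one_lt (12 * k * (C + 1) / (2 - 2 / ρ)) hρ
  rw [div_lt_iff₀ hκ] at hm
  -- after `⌈L / log ρ⌉` rounds the workers are at unit distance, after `m` more at distance `ρ ^ m`
  set N : ℝ → ℕ := fun L => ⌈1 / Real.log ρ * L⌉₊ + m with hN
  set b := 2 * ρ ^ (m + 1) with hb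
  have hNt : Tendsto (fun L => (N L : ℝ) / L) atTop (𝓝 (1 / Real.log ρ)) := by
    have h1 := tendsto_nat_ceil_mul_div_atTop (R := ℝ) (one_div_pos.2 hl).le
    have h2 : Tendsto (fun L : ℝ => (m : ℝ) / L) atTop (𝓝 0) :=
      tendsto_const_nhds.div_atTop tendsto_id
    simpa [hN, add_div] using h1.add h2
  have hlim := (tendsto_main_term k hρ (Real.log ((2 / ρ - 1) / k * (ρ - 1)) - b) hNt).add
    (tendsto_error_term k (Real.log (1 / 2)) (Real.log (1 / 2)) (one_div_pos.2 hl) hNt)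
  rw [add_zero] at hlim
  refine ⟨_, hlim.comp tendsto_neg_log_nhdsGT_zero, ?_⟩
  filter_upwards [Ioo_mem_nhdsGT (zero_lt_one' ℝ)] with x hx
  have hL : 0 < -Real.log x := neg_pos.2 (Real.log_neg hx.1 hx.2)
  set L := -Real.log x with hLdef
  have hxL : x = Real.exp (-L) := by rw [hLdef, neg_neg, Real.exp_log hx.1]
  have hpow : ρ ^ ⌈1 / Real.log ρ * L⌉₊ = Real.exp (⌈1 / Real.log ρ * L⌉₊ * Real.log ρ) := by
    rw [Real.exp_nat_mul, Real.exp_log hρ0]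
  have h1 : 1 ≤ ρ ^ ⌈1 / Real.log ρ * L⌉₊ * x := by
    rw [hpow, hxL, ← Real.exp_add]
    refine Real.one_le_exp ?_
    have := mul_le_mul_of_nonneg_right (Nat.le_ceil (1 / Real.log ρ * L)) hl.le
    rw [one_div_mul_eq_div, div_mul_cancel₀ _ hl.ne'] at this
    rw [one_div_mul_eq_div]
    linarith
  have h2 : ρ ^ ⌈1 / Real.log ρ * L⌉₊ * x ≤ ρ := by
    rw [hpow, hxL, ← Real.exp_add]
    conv_rhs => rw [← Real.exp_log hρ0]
    refine Real.exp_le_exp.2 ?_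
    have := mul_le_mul_of_nonneg_right
      (Nat.ceil_lt_add_one (a := 1 / Real.log ρ * L) (by positivity)).le hl.le
    rw [add_mul, one_div_mul_eq_div, div_mul_cancel₀ _ hl.ne'] at this
    rw [one_div_mul_eq_div]
    linarith
  have h3 : ρ ^ N L * x = ρ ^ ⌈1 / Real.log ρ * L⌉₊ * x * ρ ^ m := by
    simp only [hN, pow_add]
    ring
  have hρm : 0 < ρ ^ m := by positivity
  have hlow := (hmodel x hx.1).le_measureReal_originNeverRemoved hk hx.1 hρ hρ2 hC (N := N L)
    (b := b) (by
      rw [h3]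
      nlinarith [mul_le_mul_of_nonneg_right h1 hρm.le])
    (by
      rw [h3, hb, pow_succ]
      nlinarith [mul_le_mul_of_nonneg_right h2 hρm.le])
  obtain ⟨hpos, hlog⟩ := log_lower hk (N L) (b := b) hx.1 hρ hρ2
  refine ⟨hpos.trans_le hlow, ?_⟩
  have h4 := Real.log_le_log hpos hlow
  rw [hlog] at h4
  have h5 : Real.log x ^ 2 = L ^ 2 := by rw [hLdef]; ring
  simp only [Function.comp_apply]
  rw [h5, ← add_div, div_le_div_iff_of_pos_right (by positivity)]
  refine le_trans (le_of_eq ?_) h4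
  rw [show Real.log x = -L by rw [hLdef, neg_neg]]
  ring_nf

theorem exists_upper_bound (hk : 0 < k)
    (hmodel : ∀ x, 0 < x → IsHalflineModel k x (T x) (R x) (P x)) :
    ∃ u : ℝ → ℝ, Tendsto u (𝓝[>] 0) (𝓝 (-((k : ℝ) / (2 * Real.log 2)))) ∧
      ∀ᶠ x in 𝓝[>] 0, 0 < (P x).real (originNeverRemoved x (T x) (R x)) →
        Real.log ((P x).real (originNeverRemoved x (T x) (R x))) / Real.log x ^ 2 ≤ u x := by
  have hl : 0 < Real.log 2 := Real.log_pos one_lt_two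
  have hNt := tendsto_nat_floor_mul_div_atTop (R := ℝ) (one_div_pos.2 hl).le
  refine ⟨_, (tendsto_main_term k one_lt_two (Real.log 2) hNt).comp tendsto_neg_log_nhdsGT_zero,
    ?_⟩
  filter_upwards [Ioo_mem_nhdsGT (zero_lt_one' ℝ)] with x hx hpos
  have hL : Real.log x < 0 := Real.log_neg hx.1 hx.2
  have h1 := Real.log_le_log hpos ((hmodel x hx.1).measureReal_originNeverRemoved_le hk hx.1
    ⌊1 / Real.log 2 * -Real.log x⌋₊)
  rw [log_prod_upper hk _ hx.1] at h1
  simp only [Function.comp_apply]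
  rw [neg_sq, div_le_div_iff_of_pos_right (sq_pos_of_neg hL)]
  simpa [sub_neg_eq_add] using h1

end Limits

end GreedyCleaning

theorem lemma21 (k : ℕ) (hk : 0 < k)
    {Ω : ℝ → Type*} [∀ x, MeasurableSpace (Ω x)] (P : ∀ x, Measure (Ω x))
    [∀ x, IsProbabilityMeasure (P x)]
    (T : ∀ x, ℕ → Ω x → ℝ) (R : ∀ x, Fin k → ℕ → Ω x → ℝ)
    (hmodel : ∀ x, 0 < x → GreedyCleaning.IsHalflineModel k x (T x) (R x) (P x)) :
    Filter.Tendsto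
      (fun x : ℝ =>
        Real.log ((P x).real (GreedyCleaning.originNeverRemoved x (T x) (R x))) /
          (Real.log x) ^ 2)
      (nhdsWithin 0 (Set.Ioi 0)) (nhds (-((k : ℝ) / (2 * Real.log 2)))) := by
  have hl : 0 < Real.log 2 := Real.log_pos one_lt_two
  -- the lower bounds are for ratios `ρ < 2`; their limits tend to the right one as `ρ` tends to `2`
  have hcont : Filter.Tendsto (fun ρ : ℝ => -((k : ℝ) / (2 * Real.log ρ)))
      (nhdsWithin 2 (Set.Iio 2)) (nhds (-((k : ℝ) / (2 * Real.log 2)))) := by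
    have h1 : ContinuousAt (fun ρ : ℝ => -((k : ℝ) / (2 * Real.log ρ))) 2 :=
      (continuousAt_const.div (continuousAt_const.mul (Real.continuousAt_log two_ne_zero))
        (mul_ne_zero two_ne_zero hl.ne')).neg
    exact h1.tendsto.mono_left nhdsWithin_le_nhds
  refine tendsto_order.2 ⟨fun a ha => ?_, fun a ha => ?_⟩
  · obtain ⟨ρ, hρa, hρ⟩ := ((hcont.eventually (lt_mem_nhds ha)).and
      (Ioo_mem_nhdsLT (one_lt_two (α := ℝ)))).exists
    obtain ⟨l, hlim, hle⟩ := GreedyCleaning.exists_lower_bound hk hmodel hρ.1 hρ.2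
    filter_upwards [hle, hlim.eventually (lt_mem_nhds hρa)] with x h1 h2
    exact h2.trans_le h1.2
  · obtain ⟨u, hlim, hle⟩ := GreedyCleaning.exists_upper_bound hk hmodel
    obtain ⟨l, -, hpos⟩ := GreedyCleaning.exists_lower_bound (ρ := 3 / 2) hk hmodel
      (by norm_num) (by norm_num)
    filter_upwards [hle, hpos, hlim.eventually (gt_mem_nhds ha)] with x h1 h2 h3
    exact (h1 h2.1).trans_lt h3
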